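/- Let $N\ge 1$ and fix real numbers $x_{n,k}$, $1\le k\le n\le N$. On some probability space, for every $\gamma>0$ let $T^\gamma=(T^\gamma_{n,k})_{1\le k\le n\le N}$ be a solution, with continuous paths on the time interval $[0,1]$, of the scaled Whittaker 2d growth system $$dT^\gamma_{n,k}=\frac1{\sqrt\gamma}\,dW_{n,k}+\Bigl(e^{\gamma(T^\gamma_{n-1,k}-T^\gamma_{n,k})}-e^{\gamma(T^\gamma_{n,k}-T^\gamma_{n-1,k-1})}\Bigr)dt,\qquad T^\gamma_{n,k}(0)=x_{n,k},$$ where the $W_{n,k}$ are independent standard Brownian motions (they may depend on $\gamma$), and where the first exponential is omitted if $k=n$ and the second one if $k=1$. Let $\phi=(\phi_{n,k})_{1\le k\le n\le N}$ be continuous functions on $[0,1]$, and suppose that $\phi$ is crossed: there are $1\le k\le n<N$ and $t\in[0,1]$ such that $$\phi_{n,k}(t)<\phi_{n+1,k+1}(t)\qquad\text{or}\qquad \phi_{n+1,k}(t)<\phi_{n,k}(t).$$ (This is the case in particular if $\phi_{n,k}(t)<\phi_{n,k+1}(t)$ for some $1\le k<n\le N$ and $t\in[0,1]$.) Write $\|\cdot\|$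 for the supremum norm on $[0,1]$ and put $\log 0=-\infty$. Then, for all sufficiently small $\delta>0$, $$\lim_{\gamma\to\infty}\frac1\gamma\log\mathbb P\bigl\{\|T^\gamma_{n,k}-\phi_{n,k}\|\le\delta\ \text{ for all } 1\le k\le n\le N\bigr\}=-\infty,$$ and consequently $$\lim_{\delta\to0}\,\limsup_{\gamma\to\infty}\frac1\gamma\log\mathbb P\bigl\{\|T^\gamma_{n,k}-\phi_{n,k}\|\le\delta\ \text{ for all } 1\le k\le n\le N\bigr\}=-\infty,$$ i.e. the rate function is $+\infty$ at $\phi$. -/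

import Mathlib

open MeasureTheory ProbabilityTheory Filter Topology Set
open scoped NNReal ENNReal

namespace Whittaker

/-- The index pairs of a triangular array with `N` layers: layer `n` holds the particles
`1 ≤ k ≤ n`, for `1 ≤ n ≤ N`. Arrays are written as functions of two natural numbers;
only their entries at valid indices are ever used. -/
def Valid (N n k : ℕ) : Prop := 1 ≤ k ∧ k ≤ n ∧ n ≤ N

/-- The drift of particle `(n, k)` of the scaled system in the configuration `x`:
`e^{γ (x_{n-1,k} - x_{n,k})} - e^{γ (x_{n,k} - x_{n-1,k-1})}`,
where a term is dropped when the particle of layer `n - 1` in it does not exist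
(the first term for `k = n`, the second one for `k = 1`). -/
noncomputable def drift (γ : ℝ) (x : ℕ → ℕ → ℝ) (n k : ℕ) : ℝ :=
  (if k < n then Real.exp (γ * (x (n - 1) k - x n k)) else 0)
    - (if 1 < k then Real.exp (γ * (x n k - x (n - 1) (k - 1))) else 0)

/-- `T` solves on the time interval `[0, 1]` the scaled Whittaker 2d growth system with parameter
`γ`, `N` layers and fixed initial positions `x`, driven by the independent standard Brownian
motions `W n k`:
`dT_{n,k} = γ^{-1/2} dW_{n,k} + drift_{n,k}(T) dt`, `T_{n,k}(0) = x_{n,k}`.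
The noise is additive, so the equation is an integral equation along almost every path;
no stochastic integral occurs, and adaptedness of `T` need not be imposed. -/
structure IsScaledSystem {Ω : Type*} [MeasurableSpace Ω] (P : Measure Ω) (N : ℕ) (γ : ℝ)
    (x : ℕ → ℕ → ℝ) (W : ℕ → ℕ → ℝ≥0 → Ω → ℝ) (T : ℕ → ℕ → ℝ → Ω → ℝ) : Prop where
  brownian : ∀ n k, Valid N n k → IsBrownianReal (W n k) P
  indep : iIndepFun
    (fun (p : {p : ℕ × ℕ // Valid N p.1 p.2}) (ω : Ω) (t : ℝ≥0) => W p.1.1 p.1.2 t ω) P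
  continuous : ∀ᵐ ω ∂P, ∀ n k, Valid N n k →
    ContinuousOn (fun t => T n k t ω) (Icc 0 1)
  equation : ∀ᵐ ω ∂P, ∀ n k, Valid N n k → ∀ t ∈ Icc (0 : ℝ) 1,
    T n k t ω = x n k + 1 / Real.sqrt γ * W n k t.toNNReal ω
      + ∫ s in (0 : ℝ)..t, drift γ (fun i j => T i j s ω) n k

/-- The array of sample paths `φ` is crossed: at some time in `[0, 1]` the interlacing
`φ_{n+1,k+1} ≤ φ_{n,k} ≤ φ_{n+1,k}` fails for some `1 ≤ k ≤ n < N`. -/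
def IsCrossed (N : ℕ) (φ : ℕ → ℕ → ℝ → ℝ) : Prop :=
  ∃ n k : ℕ, 1 ≤ k ∧ k ≤ n ∧ n < N ∧ ∃ t ∈ Icc (0 : ℝ) 1,
    φ n k t < φ (n + 1) (k + 1) t ∨ φ (n + 1) k t < φ n k t

/-- A wrong order of two neighbours of the same layer is a crossing. -/
theorem isCrossed_of_row {N : ℕ} {φ : ℕ → ℕ → ℝ → ℝ} {n k : ℕ} {t : ℝ} (hk : 1 ≤ k)
    (hkn : k + 1 ≤ n) (hn : n ≤ N) (ht : t ∈ Icc (0 : ℝ) 1) (h : φ n k t < φ n (k + 1) t) :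
    IsCrossed N φ := by
  obtain ⟨m, rfl⟩ : ∃ m, n = m + 1 := ⟨n - 1, by omega⟩
  refine ⟨m, k, hk, by omega, by omega, t, ht, ?_⟩
  by_cases h' : φ (m + 1) k t < φ m k t
  · exact Or.inr h'
  · exact Or.inl (lt_of_le_of_lt (not_lt.mp h') h)

/-- The event that `T` stays `δ`-close to `φ`: `‖T_{n,k} - φ_{n,k}‖ ≤ δ` in the supremum norm on
`[0, 1]` for all `1 ≤ k ≤ n ≤ N`. -/
def closeEvent {Ω : Type*} (N : ℕ) (T : ℕ → ℕ → ℝ → Ω → ℝ) (φ : ℕ → ℕ → ℝ → ℝ) (δ : ℝ) :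
    Set Ω :=
  {ω | ∀ n k, Valid N n k → ∀ t ∈ Icc (0 : ℝ) 1, |T n k t ω - φ n k t| ≤ δ}

/-- `(1 / γ) log P(A)` as an extended real number, with `log 0 = -∞`. -/
noncomputable def scaledLogProb {Ω : Type*} [MeasurableSpace Ω] (P : Measure Ω) (γ : ℝ)
    (A : Set Ω) : EReal :=
  ((1 / γ : ℝ) : EReal) * ENNReal.log (P A)

end Whittaker

namespace Whittaker

/-! While `T` stays near a crossed `φ`, one particle feels a drift of order `e^{γc}` in a fixed
direction on a whole time interval, yet it moves only by a bounded amount. Its Brownian increment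
must therefore be of order `√γ e^{γc}`, which has probability below `e^{-γ²}`, far less than any
`e^{-Cγ}`. The danger is that the two exponentials in that drift cancel. Taking the first layer `n`
at which the interlacing with layer `n + 1` fails makes layer `n` ordered, which keeps the opposing
exponential at most `1` (`IsCrossed.exists_drift_large`). `le_abs_noise_increment` turns the drift
into noise, and `measure_le_abs_le_of_gaussian` bounds its probability. -/

/-- If the interlacing first fails below layer `n`, then layer `n` is ordered. -/
theorem row_antitone_of_interlacing {n : ℕ} {φ : ℕ → ℕ → ℝ → ℝ} {s : ℝ}
    (h : ∀ m k, m < n → 1 ≤ k → k ≤ m → φ (m + 1) (k + 1) s ≤ φ m k s ∧ φ m k s ≤ φ (m + 1) k s)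
    {k : ℕ} (hk : 1 ≤ k) (hkn : k < n) : φ n (k + 1) s ≤ φ n k s := by
  obtain ⟨m, rfl⟩ : ∃ m, n = m + 1 := ⟨n - 1, by omega⟩
  obtain ⟨h1, h2⟩ := h m k (by omega) hk (by omega)
  exact h1.trans h2

/-- A crossing occurs in a layer above which all rows are ordered at all times. -/
theorem IsCrossed.exists_ordered_row {N : ℕ} {φ : ℕ → ℕ → ℝ → ℝ} (h : IsCrossed N φ) :
    ∃ n k : ℕ, 1 ≤ k ∧ k ≤ n ∧ n < N ∧
      (∀ j, 1 ≤ j → j < n → ∀ s ∈ Icc (0 : ℝ) 1, φ n (j + 1) s ≤ φ n j s) ∧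
      ∃ t ∈ Icc (0 : ℝ) 1, φ n k t < φ (n + 1) (k + 1) t ∨ φ (n + 1) k t < φ n k t := by
  classical
  -- The least crossed layer is minimal over all times at once, so the order of its row holds on all
  -- of `[0, 1]` and not only at `t`.
  obtain ⟨k, hk, hkn, hn, t, ht, hc⟩ := Nat.find_spec h
  refine ⟨Nat.find h, k, hk, hkn, hn, fun j hj hjn s hs => ?_, t, ht, hc⟩
  refine row_antitone_of_interlacing (fun m i hm hi him => ?_) hj hjn
  have hmin := Nat.find_min h hm
  push Not at hmin
  exact hmin i hi him (hm.trans hn) s hs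

/-- A function continuous on `[0, 1]` which is positive somewhere is bounded below by a positive
constant on a nontrivial subinterval. -/
theorem exists_Icc_lt_of_pos {f : ℝ → ℝ} (hf : ContinuousOn f (Icc 0 1)) {t : ℝ}
    (ht : t ∈ Icc (0 : ℝ) 1) (hpos : 0 < f t) :
    ∃ c > 0, ∃ a b : ℝ, 0 ≤ a ∧ a < b ∧ b ≤ 1 ∧ ∀ s ∈ Icc a b, 3 * c ≤ f s := by
  have hev : ∀ᶠ s in 𝓝[Icc 0 1] t, 3 * (f t / 4) < f s :=
    (hf t ht).eventually (lt_mem_nhds (by linarith))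
  obtain ⟨ε, hε, hball⟩ := Metric.mem_nhdsWithin_iff.1 hev
  refine ⟨f t / 4, by positivity, max 0 (t - ε / 2), min 1 (t + ε / 2), le_max_left _ _,
    ?_, min_le_left _ _, fun s hs => ?_⟩
  · rw [max_lt_iff, lt_min_iff, lt_min_iff]
    exact ⟨⟨one_pos, by linarith [ht.1]⟩, by linarith [ht.2], by linarith⟩
  · obtain ⟨h1, h2⟩ := max_le_iff.1 hs.1
    obtain ⟨h3, h4⟩ := le_min_iff.1 hs.2
    refine (hball ⟨?_, h1, h3⟩).le
    rw [Metric.mem_ball, Real.dist_eq, abs_lt]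
    constructor <;> linarith

/-- Near a crossed array of paths, one particle has on a whole time interval an exponentially
large drift. -/
theorem IsCrossed.exists_drift_large {N : ℕ} {φ : ℕ → ℕ → ℝ → ℝ}
    (hφ : ∀ n k, Valid N n k → ContinuousOn (φ n k) (Icc 0 1)) (h : IsCrossed N φ) :
    ∃ m k : ℕ, Valid N m k ∧ ∃ σ : ℝ, |σ| = 1 ∧ ∃ c > 0, ∃ a b : ℝ, 0 ≤ a ∧ a < b ∧ b ≤ 1 ∧
      ∀ γ > 0, ∀ s ∈ Icc a b, ∀ y : ℕ → ℕ → ℝ, (∀ i j, Valid N i j → |y i j - φ i j s| ≤ c) →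
        Real.exp (γ * c) - 1 ≤ σ * drift γ y m k := by
  obtain ⟨n, k, hk, hkn, hn, hrow, t, ht, hlt | hlt⟩ := h.exists_ordered_row
  · have v1 : Valid N n k := ⟨hk, hkn, hn.le⟩
    have v2 : Valid N (n + 1) (k + 1) := ⟨by omega, by omega, hn⟩
    obtain ⟨c, hc, a, b, ha, hab, hb, hf⟩ :=
      exists_Icc_lt_of_pos ((hφ _ _ v2).sub (hφ _ _ v1)) ht (sub_pos.2 hlt)
    refine ⟨n + 1, k + 1, v2, -1, by simp, c, hc, a, b, ha, hab, hb, fun γ hγ s hs y hy => ?_⟩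
    have hs' : s ∈ Icc (0 : ℝ) 1 := ⟨ha.trans hs.1, hs.2.trans hb⟩
    have hfs : 3 * c ≤ φ (n + 1) (k + 1) s - φ n k s := hf s hs
    have e1 := abs_le.1 (hy _ _ v1)
    have e2 := abs_le.1 (hy _ _ v2)
    -- The gap `3 * c` loses at most `c` to each of the two coordinates, so `c` remains.
    have hbig : Real.exp (γ * c) ≤ Real.exp (γ * (y (n + 1) (k + 1) - y n k)) :=
      Real.exp_le_exp.2 (mul_le_mul_of_nonneg_left (by linarith) hγ.le)
    -- The row order puts `φ n (k + 1)` below `φ n k`, hence below `φ (n + 1) (k + 1)` by `3 * c`;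
    -- errors of at most `2 * c` keep the exponent nonpositive.
    have hsmall :
        (if k + 1 < n + 1 then Real.exp (γ * (y n (k + 1) - y (n + 1) (k + 1))) else 0) ≤ 1 := by
      split_ifs with hk'
      · have v3 : Valid N n (k + 1) := ⟨by omega, by omega, hn.le⟩
        have e3 := abs_le.1 (hy _ _ v3)
        have := hrow k hk (by omega) s hs'
        exact Real.exp_le_one_iff.2 (mul_nonpos_of_nonneg_of_nonpos hγ.le (by linarith))
      · exact zero_le_one
    rw [drift, if_pos (show 1 < k + 1 by omega)]
    simp only [Nat.add_sub_cancel]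
    linarith
  · have v1 : Valid N n k := ⟨hk, hkn, hn.le⟩
    have v2 : Valid N (n + 1) k := ⟨hk, by omega, hn⟩
    obtain ⟨c, hc, a, b, ha, hab, hb, hf⟩ :=
      exists_Icc_lt_of_pos ((hφ _ _ v1).sub (hφ _ _ v2)) ht (sub_pos.2 hlt)
    refine ⟨n + 1, k, v2, 1, by simp, c, hc, a, b, ha, hab, hb, fun γ hγ s hs y hy => ?_⟩
    have hs' : s ∈ Icc (0 : ℝ) 1 := ⟨ha.trans hs.1, hs.2.trans hb⟩
    have hfs : 3 * c ≤ φ n k s - φ (n + 1) k s := hf s hs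
    have e1 := abs_le.1 (hy _ _ v1)
    have e2 := abs_le.1 (hy _ _ v2)
    have hbig : Real.exp (γ * c) ≤ Real.exp (γ * (y n k - y (n + 1) k)) :=
      Real.exp_le_exp.2 (mul_le_mul_of_nonneg_left (by linarith) hγ.le)
    have hsmall :
        (if 1 < k then Real.exp (γ * (y (n + 1) k - y n (k - 1))) else 0) ≤ 1 := by
      split_ifs with hk'
      · obtain ⟨l, rfl⟩ : ∃ l, k = l + 1 := ⟨k - 1, by omega⟩
        have v3 : Valid N n l := ⟨by omega, by omega, hn.le⟩
        have e3 := abs_le.1 (hy _ _ v3)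
        have := hrow l (by omega) (by omega) s hs'
        simp only [Nat.add_sub_cancel]
        exact Real.exp_le_one_iff.2 (mul_nonpos_of_nonneg_of_nonpos hγ.le (by linarith))
      · exact zero_le_one
    rw [drift, if_pos (show k < n + 1 by omega)]
    simp only [Nat.add_sub_cancel]
    linarith

theorem continuousOn_drift {N : ℕ} {y : ℕ → ℕ → ℝ → ℝ} {S : Set ℝ}
    (hy : ∀ n k, Valid N n k → ContinuousOn (y n k) S) (γ : ℝ) {n k : ℕ} (hv : Valid N n k) :
    ContinuousOn (fun s => drift γ (fun i j => y i j s) n k) S := by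
  obtain ⟨h1, h2, h3⟩ := hv
  unfold drift
  refine ContinuousOn.sub ?_ ?_
  · split_ifs with h
    · exact ((continuousOn_const.mul
        ((hy (n - 1) k ⟨h1, by omega, by omega⟩).sub (hy n k ⟨h1, h2, h3⟩)))).rexp
    · exact continuousOn_const
  · split_ifs with h
    · exact ((continuousOn_const.mul
        ((hy n k ⟨h1, h2, h3⟩).sub (hy (n - 1) (k - 1) ⟨by omega, by omega, by omega⟩)))).rexp
    · exact continuousOn_const

/-- If a path with additive noise has drift at least `D` in direction `σ` on `[a, b]`, but moves
by at most `M`, then its noise has a large increment. -/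
theorem le_abs_noise_increment {u w g : ℝ → ℝ} {x₀ r σ D M a b : ℝ} (hr : 0 < r)
    (ha : 0 ≤ a) (hab : a ≤ b) (hb : b ≤ 1) (hg : ContinuousOn g (Icc 0 1))
    (hu : ∀ t ∈ Icc (0 : ℝ) 1, u t = x₀ + 1 / r * w t + ∫ s in (0 : ℝ)..t, g s)
    (hσ : |σ| = 1) (hD : ∀ s ∈ Icc a b, D ≤ σ * g s) (hM : |u b - u a| ≤ M) :
    r * ((b - a) * D - M) ≤ |w b - w a| := by
  have hint : ∀ p q : ℝ, 0 ≤ p → p ≤ q → q ≤ 1 → IntervalIntegrable g volume p q :=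
    fun p q hp hpq hq => (hg.mono (Icc_subset_Icc hp hq)).intervalIntegrable_of_Icc hpq
  have hadd : (∫ s in (0 : ℝ)..b, g s) = (∫ s in (0 : ℝ)..a, g s) + ∫ s in a..b, g s :=
    (intervalIntegral.integral_add_adjacent_intervals
      (hint 0 a le_rfl ha (hab.trans hb)) (hint a b ha hab hb)).symm
  have hlow : (b - a) * D ≤ σ * ∫ s in a..b, g s := by
    rw [← intervalIntegral.integral_const_mul]
    have := intervalIntegral.integral_mono_on hab
      (intervalIntegrable_const (c := D)) ((hint a b ha hab hb).const_mul σ) hD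
    simpa using this
  have hdiff : σ * ∫ s in a..b, g s = σ * (u b - u a) - 1 / r * (σ * (w b - w a)) := by
    rw [hu b ⟨ha.trans hab, hb⟩, hu a ⟨ha, hab.trans hb⟩, hadd]
    ring
  have h1 : σ * (u b - u a) ≤ M := by
    refine (le_abs_self _).trans ?_
    rwa [abs_mul, hσ, one_mul]
  have h2 : -(σ * (w b - w a)) ≤ |w b - w a| := by
    refine (neg_le_abs _).trans ?_
    rw [abs_mul, hσ, one_mul]
  have h3 : (b - a) * D - M ≤ 1 / r * |w b - w a| := by
    have := mul_le_mul_of_nonneg_left h2 (one_div_pos.2 hr).le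
    linarith
  calc r * ((b - a) * D - M) ≤ r * (1 / r * |w b - w a|) := mul_le_mul_of_nonneg_left h3 hr.le
    _ = |w b - w a| := by field_simp

/-! ### Gaussian tails and the logarithmic scale -/

/-- Chernoff's bound with parameter `1`, applied to `X` and `-X`. A merely exponential tail
suffices, since `R` will itself be exponentially large in `γ`. -/
theorem measure_le_abs_le_of_gaussian {Ω : Type*} [MeasurableSpace Ω] {P : Measure Ω}
    [IsProbabilityMeasure P] {X : Ω → ℝ} {v : ℝ≥0} (hX : HasLaw X (gaussianReal 0 v) P) (R : ℝ) :
    P {ω | R ≤ |X ω|} ≤ ENNReal.ofReal (2 * Real.exp (v / 2 - R)) := by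
  have tail : ∀ Y : Ω → ℝ, HasLaw Y (gaussianReal 0 v) P →
      P.real {ω | R ≤ Y ω} ≤ Real.exp (v / 2 - R) := fun Y hY => by
    have hint : Integrable (fun ω => Real.exp (1 * Y ω)) P := by
      have := integrable_exp_mul_gaussianReal (μ := 0) (v := v) 1
      rw [← hY.map_eq] at this
      exact this.comp_aemeasurable hY.aemeasurable
    refine (measure_ge_le_exp_mul_mgf R zero_le_one hint).trans_eq ?_
    rw [mgf_gaussianReal hY.map_eq, ← Real.exp_add]
    congr 1
    ring
  have hneg : HasLaw (-X) (gaussianReal 0 v) P := by simpa using gaussianReal_neg hX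
  have hsub : {ω | R ≤ |X ω|} ⊆ {ω | R ≤ X ω} ∪ {ω | R ≤ (-X) ω} := fun ω hω =>
    (le_abs (a := R) (b := X ω)).1 hω
  refine (ENNReal.le_ofReal_iff_toReal_le (measure_ne_top _ _) (by positivity)).2 ?_
  calc P.real {ω | R ≤ |X ω|} ≤ P.real {ω | R ≤ X ω} + P.real {ω | R ≤ (-X) ω} :=
        (measureReal_mono hsub).trans (measureReal_union_le _ _)
    _ ≤ 2 * Real.exp (v / 2 - R) := by linarith [tail X hX, tail _ hneg]

/-- Used with `K = v / 2 + log 2`, which absorbs the prefactor `2 e^{v/2}` of the tail bound. -/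
theorem eventually_sq_add_le_sqrt_mul_exp {c d : ℝ} (hc : 0 < c) (hd : 0 < d) (M K : ℝ) :
    ∀ᶠ γ : ℝ in atTop, γ ^ 2 + K ≤ Real.sqrt γ * (d * (Real.exp (γ * c) - 1) - M) := by
  have h1 : Tendsto (fun γ : ℝ => Real.exp (γ * c) / γ ^ 2) atTop atTop := by
    have h := (Real.tendsto_exp_div_pow_atTop 2).comp (tendsto_id.atTop_mul_const hc)
    refine (h.const_mul_atTop (show 0 < c ^ 2 by positivity)).congr fun γ => ?_
    simp only [Function.comp, id]
    rcases eq_or_ne γ 0 with rfl | hγ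
    · simp
    · field_simp
  filter_upwards [h1.eventually_ge_atTop ((1 + |K| + d + |M|) / d), eventually_ge_atTop 1]
    with γ hγ hγ1
  have hsq : 1 ≤ γ ^ 2 := one_le_pow₀ hγ1
  have h2 : (1 + |K| + d + |M|) * γ ^ 2 ≤ d * Real.exp (γ * c) := by
    rw [div_le_div_iff₀ hd (by positivity)] at hγ
    linarith
  have hA : 0 ≤ |K| + d + |M| := by positivity
  have h3 : γ ^ 2 + (|K| + d + |M|) ≤ (1 + |K| + d + |M|) * γ ^ 2 := by nlinarith
  have h4 : γ ^ 2 + |K| ≤ d * (Real.exp (γ * c) - 1) - M := by linarith [le_abs_self M]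
  have h5 : 0 ≤ γ ^ 2 + |K| := by positivity
  have h6 : γ ^ 2 + K ≤ γ ^ 2 + |K| := by linarith [le_abs_self K]
  exact (h6.trans h4).trans (le_mul_of_one_le_left (h5.trans h4) (Real.one_le_sqrt.2 hγ1))

theorem tendsto_scaledLogProb_bot {Ω : Type*} [MeasurableSpace Ω] {P : Measure Ω}
    {A : ℝ → Set Ω} (h : ∀ᶠ γ in atTop, P (A γ) ≤ ENNReal.ofReal (Real.exp (-γ ^ 2))) :
    Tendsto (fun γ => scaledLogProb P γ (A γ)) atTop (𝓝 ⊥) := by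
  rw [EReal.tendsto_nhds_bot_iff_real]
  intro r
  filter_upwards [h, eventually_gt_atTop 0, eventually_gt_atTop (-r)] with γ hγ hpos hr
  have hlog : ENNReal.log (P (A γ)) ≤ ((-γ ^ 2 : ℝ) : EReal) := by
    refine (ENNReal.log_le_log hγ).trans_eq ?_
    rw [ENNReal.log_ofReal_of_pos (Real.exp_pos _), Real.log_exp]
  calc scaledLogProb P γ (A γ) ≤ ((1 / γ : ℝ) : EReal) * ((-γ ^ 2 : ℝ) : EReal) :=
        mul_le_mul_of_nonneg_left hlog (EReal.coe_nonneg.2 (by positivity))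
    _ = ((-γ : ℝ) : EReal) := by
        rw [← EReal.coe_mul]
        congr 1
        field_simp
    _ < r := EReal.coe_lt_coe_iff.2 (by linarith)

/-- The probability of staying close to a crossed array of paths decays superexponentially. -/
theorem eventually_tendsto_scaledLogProb_closeEvent {Ω : Type*} [MeasurableSpace Ω]
    {P : Measure Ω} [IsProbabilityMeasure P] {N : ℕ} {x : ℕ → ℕ → ℝ}
    {W : ℝ → ℕ → ℕ → ℝ≥0 → Ω → ℝ} {T : ℝ → ℕ → ℕ → ℝ → Ω → ℝ}
    (hT : ∀ γ : ℝ, 0 < γ → IsScaledSystem P N γ x (W γ) (T γ)) {φ : ℕ → ℕ → ℝ → ℝ}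
    (hφ : ∀ n k, Valid N n k → ContinuousOn (φ n k) (Icc 0 1)) (hcross : IsCrossed N φ) :
    ∀ᶠ δ in 𝓝[>] (0 : ℝ),
      Tendsto (fun γ : ℝ => scaledLogProb P γ (closeEvent N (T γ) φ δ)) atTop (𝓝 ⊥) := by
  obtain ⟨m, k, hv, σ, hσ, c, hc, a, b, ha, hab, hb, hdrift⟩ := hcross.exists_drift_large hφ
  have ha' : a ∈ Icc (0 : ℝ) 1 := ⟨ha, hab.le.trans hb⟩
  have hb' : b ∈ Icc (0 : ℝ) 1 := ⟨ha.trans hab.le, hb⟩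
  filter_upwards [Ioc_mem_nhdsGT hc] with δ hδ
  -- A bound for the displacement of `T` over `[a, b]`: an error `δ` at each endpoint.
  set M : ℝ := |φ m k b - φ m k a| + 2 * δ
  set v : ℝ≥0 := nndist (b.toNNReal : ℝ) (a.toNNReal : ℝ)
  refine tendsto_scaledLogProb_bot ?_
  filter_upwards [eventually_sq_add_le_sqrt_mul_exp hc (sub_pos.2 hab) M (v / 2 + Real.log 2),
    eventually_gt_atTop 0] with γ hγ hpos
  have hsys := hT γ hpos
  set R : ℝ := Real.sqrt γ * ((b - a) * (Real.exp (γ * c) - 1) - M)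
  have hsub : closeEvent N (T γ) φ δ ≤ᵐ[P]
      {ω | R ≤ |(W γ m k b.toNNReal - W γ m k a.toNNReal) ω|} := by
    filter_upwards [hsys.continuous, hsys.equation] with ω hcont heq hω
    refine le_abs_noise_increment (u := fun t => T γ m k t ω)
      (w := fun t => W γ m k t.toNNReal ω) (Real.sqrt_pos.2 hpos) ha hab.le hb
      (continuousOn_drift hcont γ hv) (heq m k hv) hσ (fun s hs => ?_) ?_
    · exact hdrift γ hpos s hs _ fun i j hij =>
        (hω i j hij s ⟨ha.trans hs.1, hs.2.trans hb⟩).trans hδ.2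
    · have h1 := hω m k hv a ha'
      have h2 := hω m k hv b hb'
      rw [abs_le] at h1 h2 ⊢
      have h3 := le_abs_self (φ m k b - φ m k a)
      have h4 := neg_abs_le (φ m k b - φ m k a)
      constructor <;> simp only [M] <;> linarith
  have hlaw : HasLaw (W γ m k b.toNNReal - W γ m k a.toNNReal) (gaussianReal 0 v) P :=
    (hsys.brownian m k hv).toIsPreBrownianReal.hasLaw_sub _ _
  refine (measure_mono_ae hsub).trans ((measure_le_abs_le_of_gaussian hlaw R).trans ?_)
  refine ENNReal.ofReal_le_ofReal ?_
  calc 2 * Real.exp (v / 2 - R) = Real.exp (Real.log 2 + (v / 2 - R)) := by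
        rw [Real.exp_add, Real.exp_log two_pos]
    _ ≤ Real.exp (-γ ^ 2) := Real.exp_le_exp.2 (by linarith)

end Whittaker

theorem mainTheorem3 {Ω : Type*} [MeasurableSpace Ω] (P : Measure Ω) [IsProbabilityMeasure P]
    (N : ℕ) (x : ℕ → ℕ → ℝ)
    (W : ℝ → ℕ → ℕ → ℝ≥0 → Ω → ℝ) (T : ℝ → ℕ → ℕ → ℝ → Ω → ℝ)
    (hT : ∀ γ : ℝ, 0 < γ → Whittaker.IsScaledSystem P N γ x (W γ) (T γ))
    (φ : ℕ → ℕ → ℝ → ℝ)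
    (hφ : ∀ n k, Whittaker.Valid N n k → ContinuousOn (φ n k) (Icc 0 1))
    (hcross : Whittaker.IsCrossed N φ) :
    (∀ᶠ δ in 𝓝[>] (0 : ℝ),
      Tendsto (fun γ : ℝ => Whittaker.scaledLogProb P γ (Whittaker.closeEvent N (T γ) φ δ))
        atTop (𝓝 ⊥)) ∧
    Tendsto (fun δ : ℝ =>
        limsup (fun γ : ℝ => Whittaker.scaledLogProb P γ (Whittaker.closeEvent N (T γ) φ δ)) atTop)
      (𝓝[>] (0 : ℝ)) (𝓝 ⊥) := by
  have h := Whittaker.eventually_tendsto_scaledLogProb_closeEvent hT hφ hcross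
  -- For small `δ` the limsup already equals `⊥`, so it is eventually constant in `δ`.
  exact ⟨h, tendsto_const_nhds.congr' (h.mono fun δ hδ => hδ.limsup_eq.symm)⟩
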